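/- Let $A$ be a finite alphabet and let $R$ be a finite sequence of pairs of words over $A$ (arbitrary words in $A^*$ for a monoid presentation $\langle A\mid R\rangle$, nonempty words in $A^+$ for a semigroup presentation). The monoid (respectively semigroup) presented is the quotient of $A^*$ (respectively $A^+$) by the least congruence containing all pairs in $R$. A relation word is a word which appears as one side of a relation in $R$. A piece is a word which is a factor of two different relation words, or a factor of the same relation word in two different (possibly overlapping) places. The presentation satisfies $C(3)$ if no relation word can be written as a product of strictly fewer than $3$ pieces (in particular, since the empty product is allowed, no relation word is empty). **Proposition.** (i) Let $M$ be a monoid isomorphic to the monoid presented by a finite monoid presentation satisfying $C(3)$. Then $M$ is torsion-free, i.e. every element $a\neq 1$ of $M$ has infinitely many distinct powers $a, a^2, a^3, \dots$ (the subsemigroup generated by $a$ is infinite); and $M$ is $\mathscr{J}$-trivial, i.e. distinct elements of $M$ generate distinct principal two-sided ideals. (ii) Let $S$ be a semigroup isomorphic to the semigroup presented by a finite semigroup presentation satisfying $C(3)$. Then $S$ is torsion-free, i.e. every element of $S$ has infinitely many distinct positive powers; and $S$ is $\mathscr{J}$-trivial, i.e. distinct elements of $S$ generate distinct principal two-sided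 ideals $S^1aS^1$. -/

import Mathlib

namespace SmallOverlap

/-- The relation words of a finite sequence `R` of relations: the words which appear as one side of
a relation in `R`. -/
def relationWords {W : Type*} (R : List (W × W)) : Set W :=
  {w | ∃ r ∈ R, w = r.1 ∨ w = r.2}

/-- A piece, with respect to a set `W` of relation words: a word which is a factor of two different
relation words, or which is a factor of one relation word in two different (possibly overlapping)
places. -/
def IsPiece {A : Type*} (W : Set (FreeMonoid A)) (p : FreeMonoid A) : Prop :=
  (∃ u ∈ W, ∃ v ∈ W, u ≠ v ∧
    (∃ x y : FreeMonoid A, u = x * p * y) ∧ (∃ x y : FreeMonoid A, v = x * p * y)) ∨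
  (∃ w ∈ W, ∃ x₁ y₁ x₂ y₂ : FreeMonoid A,
    x₁ ≠ x₂ ∧ w = x₁ * p * y₁ ∧ w = x₂ * p * y₂)

/-- The small overlap condition `C(m)` for a set `W` of relation words: no relation word is a
product of strictly fewer than `m` pieces. -/
def SmallOverlapCondition {A : Type*} (m : ℕ) (W : Set (FreeMonoid A)) : Prop :=
  ∀ w ∈ W, ∀ ps : List (FreeMonoid A),
    (∀ p ∈ ps, IsPiece W p) → ps.prod = w → m ≤ ps.length

/-- A finite monoid presentation over the alphabet `A`: a finite sequence of pairs of words. -/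
structure MonoidPresentation (A : Type*) where
  rels : List (FreeMonoid A × FreeMonoid A)

/-- The presentation satisfies `C(m)`. -/
def MonoidPresentation.SatisfiesC {A : Type*} (P : MonoidPresentation A) (m : ℕ) : Prop :=
  SmallOverlapCondition m (relationWords P.rels)

/-- The monoid presented: the quotient of the free monoid by the least congruence containing the
relations. -/
abbrev MonoidPresentation.Presented {A : Type*} (P : MonoidPresentation A) : Type _ :=
  PresentedMonoid (fun u v : FreeMonoid A => (u, v) ∈ P.rels)

/-- A finite semigroup presentation over the alphabet `A`: a finite sequence of pairs of nonempty
words. -/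
structure SemigroupPresentation (A : Type*) where
  rels : List (FreeSemigroup A × FreeSemigroup A)

/-- The inclusion of the free semigroup (nonempty words) into the free monoid (all words). -/
def toWord {A : Type*} : FreeSemigroup A →ₙ* FreeMonoid A :=
  FreeSemigroup.lift FreeMonoid.of

/-- The presentation satisfies `C(m)`. Empty factors do not change which nonempty words are products
of fewer than `m` pieces, so pieces may be formed among all words. -/
def SemigroupPresentation.SatisfiesC {A : Type*} (P : SemigroupPresentation A) (m : ℕ) : Prop :=
  SmallOverlapCondition m (toWord '' relationWords P.rels)

/-- The semigroup presented: the quotient of the free semigroup by the least congruence containing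
the relations. -/
abbrev SemigroupPresentation.Presented {A : Type*} (P : SemigroupPresentation A) : Type _ :=
  (conGen (fun u v : FreeSemigroup A => (u, v) ∈ P.rels)).Quotient

/-- An element of a semigroup is a torsion element if it has only finitely many distinct positive
powers, that is, if the subsemigroup it generates is finite. -/
def IsTorsionElement {S : Type*} [Semigroup S] (a : S) : Prop :=
  (Subsemigroup.closure {a} : Set S).Finite

/-- The principal two-sided ideal `S¹ a S¹` generated by an element `a` of a semigroup. -/
def principalIdeal {S : Type*} [Semigroup S] (a : S) : Set S :=
  {b | b = a ∨ (∃ s, b = s * a) ∨ (∃ t, b = a * t) ∨ ∃ s t, b = s * a * t}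

/-- Distinct elements generate distinct principal ideals. -/
def IsJTrivial (S : Type*) [Semigroup S] : Prop :=
  ∀ a b : S, a ≠ b → principalIdeal a ≠ principalIdeal b

end SmallOverlap

namespace SmallOverlap

/-! ### Coverings of words by segments -/

section Words

variable {A : Type*}

/-! Under `C(3)`, rewriting by a relation preserves the least number of segments (factors of
relation words, or at most single letters) whose product is a given word (`IsCovered.replace`).
Segments have bounded length, so all words representing one element have bounded length
(`exists_length_le_of_coverCon`). Sending an element to the length of its longest representative is
then superadditive (`exists_superadditive`) and vanishes at most at the identity. Hence powers grow
without bound, and elements dividing each other have equal value, which forces the multipliers to be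
trivial. -/

theorem exists_of_mul_eq_mul {a b c d : FreeMonoid A} (h : a * b = c * d) :
    (∃ e, c = a * e ∧ b = e * d) ∨ (∃ e, a = c * e ∧ d = e * b) :=
  List.append_eq_append_iff.1 h

theorem freeMonoid_mul_eq_one {a b : FreeMonoid A} (h : a * b = 1) : a = 1 ∧ b = 1 :=
  List.append_eq_nil_iff.1 h

theorem exists_split_of_prod_eq_mul (gs : List (FreeMonoid A)) (hgs : gs ≠ [])
    {a b : FreeMonoid A} (h : gs.prod = a * b) :
    ∃ gs₁ g g' gs₂, gs = gs₁ ++ (g * g') :: gs₂ ∧ a = gs₁.prod * g ∧ b = g' * gs₂.prod := by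
  induction gs generalizing a with
  | nil => exact absurd rfl hgs
  | cons x gs ih =>
    rw [List.prod_cons] at h
    rcases exists_of_mul_eq_mul h with ⟨e, ha, he⟩ | ⟨e, hx, hb⟩
    · by_cases hnil : gs = []
      · subst hnil
        obtain ⟨rfl, rfl⟩ := freeMonoid_mul_eq_one he.symm
        exact ⟨[], x, 1, [], by simp, by simpa using ha, by simp⟩
      · obtain ⟨gs₁, g, g', gs₂, rfl, rfl, rfl⟩ := ih hnil he
        exact ⟨x :: gs₁, g, g', gs₂, by simp, by simp [ha, mul_assoc], rfl⟩
    · exact ⟨[], a, e, gs, by simp [hx], by simp, hb⟩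

/-- A segment, with respect to a set of relation words: a factor of a relation word, or a word with
at most one letter. -/
def IsSegment (W : Set (FreeMonoid A)) (g : FreeMonoid A) : Prop :=
  (∃ r ∈ W, ∃ x y, r = x * g * y) ∨ g.length ≤ 1

theorem isSegment_of_mem {W : Set (FreeMonoid A)} {r : FreeMonoid A} (hr : r ∈ W) :
    IsSegment W r :=
  Or.inl ⟨r, hr, 1, 1, by simp⟩

theorem IsSegment.left {W : Set (FreeMonoid A)} {g g' : FreeMonoid A}
    (h : IsSegment W (g * g')) : IsSegment W g := by
  rcases h with ⟨r, hr, x, y, rfl⟩ | h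
  · exact Or.inl ⟨_, hr, x, g' * y, by simp only [mul_assoc]⟩
  · rw [FreeMonoid.length_mul] at h
    exact Or.inr (by omega)

theorem IsSegment.right {W : Set (FreeMonoid A)} {g g' : FreeMonoid A}
    (h : IsSegment W (g * g')) : IsSegment W g' := by
  rcases h with ⟨r, hr, x, y, rfl⟩ | h
  · exact Or.inl ⟨_, hr, x * g, y, by simp only [mul_assoc]⟩
  · rw [FreeMonoid.length_mul] at h
    exact Or.inr (by omega)

/-- A non-piece determines both the relation word containing it and its position there. -/
theorem eq_and_eq_of_not_isPiece {W : Set (FreeMonoid A)} {u r p x y x' y' : FreeMonoid A}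
    (hu : u ∈ W) (hr : r ∈ W) (hp : ¬ IsPiece W p) (hux : u = x * p * y)
    (hrx : r = x' * p * y') : x' = x ∧ y' = y := by
  have hur : u = r := by
    by_contra hne
    exact hp (Or.inl ⟨u, hu, r, hr, hne, ⟨x, y, hux⟩, ⟨x', y', hrx⟩⟩)
  subst hur
  have hx : x' = x := by
    by_contra hne
    exact hp (Or.inr ⟨u, hu, x', y', x, y, hne, hrx, hux⟩)
  subst hx
  exact ⟨rfl, mul_left_cancel (hrx.symm.trans hux)⟩

theorem isPiece_one {W : Set (FreeMonoid A)} {u : FreeMonoid A} (hu : u ∈ W) (hne : u ≠ 1) :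
    IsPiece W 1 :=
  Or.inr ⟨u, hu, 1, u, u, 1, hne.symm, by simp, by simp⟩

/-- A segment containing a factor `p` of a relation word `u`, where `p` is not a piece, lies inside
`u`. -/
theorem IsSegment.exists_eq_of_not_isPiece {W : Set (FreeMonoid A)} {u p x y g h : FreeMonoid A}
    (hu : u ∈ W) (hne : u ≠ 1) (hp : ¬ IsPiece W p) (hux : u = x * p * y)
    (hs : IsSegment W (g * p * h)) : ∃ x₀ y₀, x = x₀ * g ∧ y = h * y₀ := by
  rcases hs with ⟨r, hr, x', y', hrx⟩ | hs
  · obtain ⟨rfl, rfl⟩ := eq_and_eq_of_not_isPiece (x' := x' * g) (y' := h * y') hu hr hp hux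
      (by simp only [hrx, mul_assoc])
    exact ⟨x', y', rfl, rfl⟩
  -- The empty word is a piece, so `p` already fills a segment of at most one letter.
  · have hp1 : p.length ≠ 0 := fun h0 =>
      hp (FreeMonoid.length_eq_zero.1 h0 ▸ isPiece_one hu hne)
    simp only [FreeMonoid.length_mul] at hs
    have hg : g = 1 := FreeMonoid.length_eq_zero.1 (by omega)
    have hh : h = 1 := FreeMonoid.length_eq_zero.1 (by omega)
    exact ⟨x, y, by simp [hg], by simp [hh]⟩

/-- The word `w` is a product of at most `n` segments. -/
def IsCovered (W : Set (FreeMonoid A)) (n : ℕ) (w : FreeMonoid A) : Prop :=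
  ∃ gs : List (FreeMonoid A), gs.length ≤ n ∧ gs.prod = w ∧ ∀ g ∈ gs, IsSegment W g

theorem isCovered_length (W : Set (FreeMonoid A)) (w : FreeMonoid A) :
    IsCovered W w.length w := by
  refine ⟨w.toList.map FreeMonoid.of, by simp [FreeMonoid.length], ?_, ?_⟩
  · induction w using FreeMonoid.inductionOn' with
    | one => simp
    | of_mul a w ih => simp [ih]
  · intro g hg
    obtain ⟨a, -, rfl⟩ := List.mem_map.1 hg
    exact Or.inr (by simp)

theorem IsCovered.length_le {W : Set (FreeMonoid A)} {L n : ℕ} (hL : 1 ≤ L)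
    (hW : ∀ r ∈ W, r.length ≤ L) {w : FreeMonoid A} (h : IsCovered W n w) :
    w.length ≤ n * L := by
  obtain ⟨gs, hn, rfl, hgs⟩ := h
  suffices gs.prod.length ≤ gs.length * L from this.trans (Nat.mul_le_mul_right L hn)
  clear hn
  induction gs with
  | nil => simp
  | cons g gs ih =>
    have hg : g.length ≤ L := by
      rcases hgs g (by simp) with ⟨r, hr, x, y, rfl⟩ | hg
      · have := hW _ hr
        simp only [FreeMonoid.length_mul] at this
        omega
      · omega
    have := ih fun g' hg' => hgs g' (by simp [hg'])
    rw [List.prod_cons, FreeMonoid.length_mul, List.length_cons, Nat.succ_mul]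
    omega

/-- Under `C(3)`, replacing an occurrence of a relation word by another relation word does not
increase the number of segments needed. -/
theorem IsCovered.replace {W : Set (FreeMonoid A)} (hC : SmallOverlapCondition 3 W)
    {u v : FreeMonoid A} (hu : u ∈ W) (hv : v ∈ W) {n : ℕ} {a b : FreeMonoid A}
    (h : IsCovered W n (a * u * b)) : IsCovered W n (a * v * b) := by
  have hne : u ≠ 1 := by
    rintro rfl
    simpa using hC 1 hu [] (by simp) (by simp)
  have hup : ¬ IsPiece W u := fun hp => by
    simpa using hC u hu [u] (by simpa using hp) (by simp)
  have hvs := isSegment_of_mem hv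
  obtain ⟨gs, hn, hprod, hgs⟩ := h
  have hnil : gs ≠ [] := by
    rintro rfl
    exact hne (freeMonoid_mul_eq_one (freeMonoid_mul_eq_one hprod.symm).1).2
  rw [mul_assoc] at hprod
  obtain ⟨gs₁, g, p, gs₂, rfl, rfl, hub⟩ := exists_split_of_prod_eq_mul gs hnil hprod
  clear hprod hnil
  simp only [List.mem_append, List.mem_cons, or_imp, forall_and, forall_eq, List.length_append,
    List.length_cons] at hgs hn
  obtain ⟨h₁, hgp, h₂⟩ := hgs
  rcases exists_of_mul_eq_mul hub with ⟨h, rfl, rfl⟩ | ⟨u', hu', hgs₂⟩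
  -- `u` lies within one segment; as `u` is not a piece, that segment is `u` itself.
  · obtain ⟨x₀, y₀, hx, hy⟩ := IsSegment.exists_eq_of_not_isPiece (x := 1) (y := 1) (g := g)
      (h := h) hu hne hup (by simp) (by rwa [mul_assoc])
    obtain ⟨-, rfl⟩ := freeMonoid_mul_eq_one hx.symm
    obtain ⟨rfl, -⟩ := freeMonoid_mul_eq_one hy.symm
    refine ⟨gs₁ ++ v :: gs₂, by simpa using hn, by simp [mul_assoc], ?_⟩
    simp only [List.mem_append, List.mem_cons, or_imp, forall_and, forall_eq]
    exact ⟨h₁, hvs, h₂⟩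
  · by_cases hnil : gs₂ = []
    · subst hnil
      obtain ⟨rfl, rfl⟩ := freeMonoid_mul_eq_one hgs₂.symm
      obtain rfl : u = p := by simpa using hu'
      obtain ⟨x₀, -, hx, -⟩ := IsSegment.exists_eq_of_not_isPiece (x := 1) (y := 1) (g := g)
        (h := 1) hu hne hup (by simp) (by simpa using hgp)
      obtain ⟨-, rfl⟩ := freeMonoid_mul_eq_one hx.symm
      refine ⟨gs₁ ++ [v], by simpa using hn, by simp, ?_⟩
      simp only [List.mem_append, List.mem_singleton, or_imp, forall_and, forall_eq]
      exact ⟨h₁, hvs⟩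
    obtain ⟨gs₃, q, h, gs₄, rfl, rfl, rfl⟩ := exists_split_of_prod_eq_mul gs₂ hnil hgs₂
    clear hgs₂ hnil
    simp only [List.mem_append, List.mem_cons, or_imp, forall_and, forall_eq, List.length_append,
      List.length_cons] at h₂ hn
    obtain ⟨h₃, hqh, h₄⟩ := h₂
    by_cases hnil : gs₃ = []
    · subst hnil
      simp only [List.prod_nil, one_mul, List.length_nil] at hu' hn
      -- `u = p * q` straddles two segments. By `C(3)`, `p` and `q` are not both pieces; the segment
      -- containing a non-piece does not stick out of `u`, so only one remnant survives next to `v`.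
      by_cases hp : IsPiece W p
      · have hq : ¬ IsPiece W q := fun hq => by
          simpa using hC u hu [p, q] (by simp [hp, hq]) (by simp [hu'])
        obtain ⟨-, y₀, -, hy⟩ := IsSegment.exists_eq_of_not_isPiece (x := p) (y := 1) (g := 1)
          (h := h) hu hne hq (by simp [hu']) (by simpa using hqh)
        obtain ⟨rfl, -⟩ := freeMonoid_mul_eq_one hy.symm
        refine ⟨gs₁ ++ g :: v :: gs₄, by simp; omega, by simp [mul_assoc], ?_⟩
        simp only [List.mem_append, List.mem_cons, or_imp, forall_and, forall_eq]
        exact ⟨h₁, hgp.left, hvs, h₄⟩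
      · obtain ⟨x₀, -, hx, -⟩ := IsSegment.exists_eq_of_not_isPiece (x := 1) (y := q) (g := g)
          (h := 1) hu hne hp (by simp [hu']) (by simpa using hgp)
        obtain ⟨-, rfl⟩ := freeMonoid_mul_eq_one hx.symm
        refine ⟨gs₁ ++ v :: h :: gs₄, by simp; omega, by simp [mul_assoc], ?_⟩
        simp only [List.mem_append, List.mem_cons, or_imp, forall_and, forall_eq]
        exact ⟨h₁, hvs, hqh.right, h₄⟩
    -- `u` meets at least three segments: `v` replaces the inner ones and both outer remnants are
    -- kept.
    · have := List.length_pos_of_ne_nil hnil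
      refine ⟨gs₁ ++ g :: v :: h :: gs₄, by simp; omega, by simp [mul_assoc], ?_⟩
      simp only [List.mem_append, List.mem_cons, or_imp, forall_and, forall_eq]
      exact ⟨h₁, hgp.left, hvs, hqh.right, h₄⟩

/-- The congruence relating two words which, in every context, need equally many segments. -/
def coverCon (W : Set (FreeMonoid A)) : Con (FreeMonoid A) where
  r w w' := ∀ n a b, IsCovered W n (a * w * b) ↔ IsCovered W n (a * w' * b)
  iseqv := ⟨fun _ _ _ _ => Iff.rfl, fun h n a b => (h n a b).symm,
    fun h h' n a b => (h n a b).trans (h' n a b)⟩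
  mul' {w x y z} h h' n a b := by
    have e₁ := h n a (y * b)
    have e₂ := h' n (a * x) b
    simp only [mul_assoc] at e₁ e₂ ⊢
    exact e₁.trans e₂

theorem coverCon_of_mem {W : Set (FreeMonoid A)} (hC : SmallOverlapCondition 3 W)
    {u v : FreeMonoid A} (hu : u ∈ W) (hv : v ∈ W) : coverCon W u v :=
  fun _ _ _ => ⟨fun h => h.replace hC hu hv, fun h => h.replace hC hv hu⟩

theorem exists_length_le_of_coverCon {W : Set (FreeMonoid A)} (hW : W.Finite)
    (w : FreeMonoid A) : ∃ N, ∀ w', coverCon W w' w → w'.length ≤ N := by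
  obtain ⟨L, hL⟩ := (hW.image FreeMonoid.length).bddAbove
  -- `w` is covered by its letters. The `+ 1` makes the bound on segment length valid for letters
  -- even when `L = 0`.
  refine ⟨w.length * (L + 1), fun w' h => ?_⟩
  have hc : IsCovered W w.length w' := by
    simpa using (h w.length 1 1).2 (by simpa using isCovered_length W w)
  exact hc.length_le (by omega) fun r hr => (hL ⟨r, hr, rfl⟩).trans (by omega)

theorem finite_relationWords {F : Type*} (R : List (F × F)) : (relationWords R).Finite := by
  refine (((R.map Prod.fst) ++ (R.map Prod.snd)).finite_toSet).subset ?_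
  rintro w ⟨r, hr, rfl | rfl⟩
  · simpa using Or.inl ⟨r.2, hr⟩
  · simpa using Or.inr ⟨r.1, hr⟩

theorem length_toWord (w : FreeSemigroup A) : (toWord w).length = w.length := by
  induction w using FreeSemigroup.recOnMul with
  | ih1 x => simp [toWord]
  | ih2 x y h₁ h₂ => simp only [map_mul, FreeMonoid.length_mul, FreeSemigroup.length_mul, h₁, h₂]

end Words

/-! ### Superadditive functions on semigroups -/

section LengthFunctions

variable {S : Type*} [Semigroup S]

theorem not_isTorsionElement_of_superadditive {f : S → ℕ} (hf : ∀ a b, f a + f b ≤ f (a * b))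
    {a : S} (ha : f a ≠ 0) : ¬ IsTorsionElement a := by
  intro h
  obtain ⟨N, hN⟩ := (h.image f).bddAbove
  have key : ∀ n, ∃ x ∈ Subsemigroup.closure {a}, n ≤ f x := by
    intro n
    induction n with
    | zero => exact ⟨a, Subsemigroup.subset_closure rfl, Nat.zero_le _⟩
    | succ n ih =>
      obtain ⟨x, hx, hn⟩ := ih
      have := hf x a
      exact ⟨x * a, mul_mem hx (Subsemigroup.subset_closure rfl), by omega⟩
  obtain ⟨x, hx, hn⟩ := key (N + 1)
  have : f x ≤ N := hN ⟨x, hx, rfl⟩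
  omega

theorem le_of_mem_principalIdeal {f : S → ℕ} (hf : ∀ a b, f a + f b ≤ f (a * b)) {a b : S}
    (h : b ∈ principalIdeal a) : f a ≤ f b := by
  rcases h with rfl | ⟨s, rfl⟩ | ⟨t, rfl⟩ | ⟨s, t, rfl⟩
  · exact le_rfl
  · have := hf s a
    omega
  · have := hf a t
    omega
  · have := hf s a
    have := hf (s * a) t
    omega

/-- Equal ideals force `f a = f b`, so the multipliers taking `a` to `b` have value `0` and act
trivially. -/
theorem isJTrivial_of_superadditive {f : S → ℕ} (hf : ∀ a b, f a + f b ≤ f (a * b))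
    (h₀ : ∀ s, f s = 0 → ∀ x, s * x = x ∧ x * s = x) : IsJTrivial S := by
  intro a b hab h
  have hb : b ∈ principalIdeal a := h ▸ Or.inl rfl
  have ha : a ∈ principalIdeal b := h ▸ Or.inl rfl
  have hba := le_of_mem_principalIdeal hf ha
  rcases hb with rfl | ⟨s, rfl⟩ | ⟨t, rfl⟩ | ⟨s, t, rfl⟩
  · exact hab rfl
  · have := hf s a
    exact hab (h₀ s (by omega) a).1.symm
  · have := hf a t
    exact hab (h₀ t (by omega) a).2.symm
  · have := hf s a
    have := hf (s * a) t
    rw [(h₀ t (by omega) _).2, (h₀ s (by omega) a).1] at hab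
    exact hab rfl

/-- If the representatives of every element of a quotient `S` of `F` have bounded length, then
there is a superadditive function on `S` which bounds all these lengths. -/
theorem exists_superadditive {F : Type*} [Mul F] (π : F →ₙ* S) (hπ : Function.Surjective π)
    (ℓ : F → ℕ) (hℓ : ∀ x y, ℓ (x * y) = ℓ x + ℓ y) (hb : ∀ w, ∃ N, ∀ w', π w' = π w → ℓ w' ≤ N) :
    ∃ f : S → ℕ, (∀ a b, f a + f b ≤ f (a * b)) ∧ ∀ w, ℓ w ≤ f (π w) := by
  have hbdd : ∀ a, BddAbove (ℓ '' {w | π w = a}) := by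
    intro a
    obtain ⟨w, rfl⟩ := hπ a
    obtain ⟨N, hN⟩ := hb w
    exact ⟨N, by rintro _ ⟨w', hw', rfl⟩; exact hN w' hw'⟩
  have hne : ∀ a, (ℓ '' {w | π w = a}).Nonempty := fun a =>
    (hπ a).elim fun w hw => ⟨_, w, hw, rfl⟩
  refine ⟨fun a => sSup (ℓ '' {w | π w = a}), fun a b => ?_, fun w =>
    le_csSup (hbdd _) ⟨w, rfl, rfl⟩⟩
  -- The product of longest representatives of `a` and `b` represents `a * b`.
  obtain ⟨w, hw, hwa⟩ := Nat.sSup_mem (hne a) (hbdd a)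
  obtain ⟨x, hx, hxb⟩ := Nat.sSup_mem (hne b) (hbdd b)
  simp only [← hwa, ← hxb, ← hℓ]
  exact le_csSup (hbdd _) ⟨w * x, by simp_all, rfl⟩

end LengthFunctions

/-! ### Application to `C(3)` presentations -/

theorem MonoidPresentation.SatisfiesC.conGen_le_coverCon {A : Type*} {P : MonoidPresentation A}
    (hP : P.SatisfiesC 3) :
    conGen (fun u v => (u, v) ∈ P.rels) ≤ coverCon (relationWords P.rels) :=
  Con.conGen_le.2 fun _ _ h => coverCon_of_mem hP ⟨_, h, Or.inl rfl⟩ ⟨_, h, Or.inr rfl⟩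

theorem SemigroupPresentation.SatisfiesC.conGen_le_comap_coverCon {A : Type*}
    {P : SemigroupPresentation A} (hP : P.SatisfiesC 3) :
    conGen (fun u v => (u, v) ∈ P.rels) ≤
      (coverCon (toWord '' relationWords P.rels)).comap toWord (map_mul toWord) :=
  Con.conGen_le.2 fun _ _ h =>
    coverCon_of_mem hP ⟨_, ⟨_, h, Or.inl rfl⟩, rfl⟩ ⟨_, ⟨_, h, Or.inr rfl⟩, rfl⟩

theorem MonoidPresentation.SatisfiesC.torsionFree_and_isJTrivial {A : Type*}
    {P : MonoidPresentation A} (hP : P.SatisfiesC 3) {M : Type*} [Monoid M]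
    (e : M ≃* P.Presented) : (∀ a : M, a ≠ 1 → ¬ IsTorsionElement a) ∧ IsJTrivial M := by
  let π : FreeMonoid A →* M := e.symm.toMonoidHom.comp (PresentedMonoid.mk _)
  have hπ : Function.Surjective π := e.symm.surjective.comp PresentedMonoid.surjective_mk
  obtain ⟨f, hf, hle⟩ := exists_superadditive (π : FreeMonoid A →ₙ* M) hπ FreeMonoid.length
    FreeMonoid.length_mul fun w => by
      obtain ⟨N, hN⟩ := exists_length_le_of_coverCon (finite_relationWords P.rels) w
      exact ⟨N, fun w' h => hN w' (hP.conGen_le_coverCon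
        (PresentedMonoid.mk_eq_mk_iff.1 (e.symm.injective h)))⟩
  have h₀ : ∀ a, f a = 0 → a = 1 := by
    intro a ha
    obtain ⟨w, rfl⟩ := hπ a
    have hw : w.length ≤ f (π w) := hle w
    have hw1 : w = 1 := FreeMonoid.length_eq_zero.1 (by omega)
    rw [hw1, map_one]
  exact ⟨fun a ha => not_isTorsionElement_of_superadditive hf (mt (h₀ a) ha),
    isJTrivial_of_superadditive hf fun s hs x => by simp [h₀ s hs]⟩

theorem SemigroupPresentation.SatisfiesC.torsionFree_and_isJTrivial {A : Type*}
    {P : SemigroupPresentation A} (hP : P.SatisfiesC 3) {S : Type*} [Semigroup S]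
    (e : S ≃* P.Presented) : (∀ a : S, ¬ IsTorsionElement a) ∧ IsJTrivial S := by
  let π : FreeSemigroup A →ₙ* S :=
    { toFun := fun w => e.symm (w : P.Presented)
      map_mul' := fun x y => by rw [Con.coe_mul, map_mul] }
  have hπ : Function.Surjective π := e.symm.surjective.comp Quotient.mk_surjective
  obtain ⟨f, hf, hle⟩ := exists_superadditive π hπ FreeSemigroup.length
    FreeSemigroup.length_mul fun w => by
      obtain ⟨N, hN⟩ := exists_length_le_of_coverCon ((finite_relationWords P.rels).image toWord)
        (toWord w)
      exact ⟨N, fun w' h => length_toWord w' ▸ hN _ (hP.conGen_le_comap_coverCon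
        ((Con.eq _).1 (e.symm.injective h)))⟩
  have h₀ : ∀ a, f a ≠ 0 := by
    intro a
    obtain ⟨w, rfl⟩ := hπ a
    exact (lt_of_lt_of_le (Nat.succ_pos _) (hle w)).ne'
  exact ⟨fun a => not_isTorsionElement_of_superadditive hf (h₀ a),
    isJTrivial_of_superadditive hf fun s hs => absurd hs (h₀ s)⟩

end SmallOverlap

open SmallOverlap in
theorem mainTheorem4 :
    (∀ (A : Type*) [Finite A] (P : MonoidPresentation A), P.SatisfiesC 3 →
      ∀ (M : Type*) [Monoid M], Nonempty (M ≃* P.Presented) →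
        (∀ a : M, a ≠ 1 → ¬ IsTorsionElement a) ∧ IsJTrivial M) ∧
    (∀ (A : Type*) [Finite A] (P : SemigroupPresentation A), P.SatisfiesC 3 →
      ∀ (S : Type*) [Semigroup S], Nonempty (S ≃* P.Presented) →
        (∀ a : S, ¬ IsTorsionElement a) ∧ IsJTrivial S) :=
  ⟨fun _ _ _ hP _ _ ⟨e⟩ => hP.torsionFree_and_isJTrivial e,
    fun _ _ _ hP _ _ ⟨e⟩ => hP.torsionFree_and_isJTrivial e⟩
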